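/- Let $\mathcal S,\mathcal A$ be finite nonempty sets, $K\ge 1$, $L\ge 0$, $\gamma\in[0,1)$, $\beta>0$; let $T(\cdot\mid s,a)$ be transition probabilities on $\mathcal S$, $\mu_0$ an initial distribution on $\mathcal S$, $r^{(1)},\dots,r^{(K)},c^{(1)},\dots,c^{(L)}:\mathcal S\times\mathcal A\to\mathbb R$ rewards, and $C^{(1)},\dots,C^{(L)}\in\mathbb R$ thresholds. Let $R$ be the set of all $\rho:\mathcal S\times\mathcal A\to[0,\infty)$ with $$\sum_{a'}\rho(s',a')=\mu_0(s')+\gamma\sum_{(s,a)}T(s'\mid s,a)\rho(s,a)\qquad\forall s',$$ and put $E(\rho)=-\sum_{s,a}\rho(s,a)\log\frac{\rho(s,a)}{\sum_{a'}\rho(s,a')}$ (with terms with $\rho(s,a)=0$ equal to $0$). Consider the program $$\text{(P)}\qquad \max_{\rho\in R}\ \min_{1\le k\le K}\sum_{(s,a)}r^{(k)}(s,a)\rho(s,a)+\beta E(\rho)\quad\text{s.t.}\quad \sum_{(s,a)}c^{(l)}(s,a)\rho(s,a)\ge C^{(l)},\ \ 1\le l\le L.$$ Its Lagrangian dual (D),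 obtained by writing the minimum as $\max b$ subject to $\sum r^{(k)}\rho\ge b$, is to minimize over $u\in\mathbb R^L_{\ge0}$, $w\in\mathbb R^K_{\ge0}$, $\xi\in\mathbb R^{\mathcal S\times\mathcal A}_{\ge0}$, $v\in\mathbb R^{\mathcal S}$ the extended-real function $$\begin{aligned}g(u,w,v,\xi)=\sup_{\rho\ge0,\,b\in\mathbb R}\Big[&b+\beta E(\rho)+\sum_k w_k\Big(\sum_{(s,a)} r^{(k)}(s,a)\rho(s,a)-b\Big)+\sum_l u_l\Big(\sum_{(s,a)} c^{(l)}(s,a)\rho(s,a)-C^{(l)}\Big)\\&+\sum_{s'}v(s')\Big(\mu_0(s')+\gamma\sum_{(s,a)}T(s'\mid s,a)\rho(s,a)-\sum_a\rho(s',a)\Big)+\sum_{(s,a)}\xi(s,a)\rho(s,a)\Big].\end{aligned}$$ For $u\in\mathbb R^L$, $w\in\mathbb R^K$ define $\mathcal T_{u,w}:\mathbb R^{\mathcal S}\to\mathbb R^{\mathcal S}$ by $$[\mathcal T_{u,w}v](s)=\beta\log\sum_a\exp\Big[\tfrac1\beta\Big\{\sum_l u_lc^{(l)}(s,a)+\sum_k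 w_kr^{(k)}(s,a)+\gamma\sum_{s'}T(s'\mid s,a)v(s')\Big\}\Big].$$ 1. For all $u\in\mathbb R^L$, $w\in\mathbb R^K$ the operator $\mathcal T_{u,w}$ has exactly one fixed point $v^*_{u,w}$, and $v^*_{u,w}(s)$ is convex in $(u,w)\in\mathbb R^{L+K}$ for each $s$. 2. Let $\Delta^K$ be the probability simplex in $\mathbb R^K$ and $\mathcal L(u,w)=\sum_s\mu_0(s)v^*_{u,w}(s)-\sum_l u_lC^{(l)}$. The program $\min\{\mathcal L(u,w): u\in\mathbb R^L_{\ge0},\ w\in\Delta^K\}$ is convex and equivalent to (D): for $u\ge0$, $w\ge0$, $\xi\ge 0$, one has $g(u,w,v,\xi)=+\infty$ if $w\notin\Delta^K$, while if $w\in\Delta^K$ then $\min_{v,\;\xi\ge0}g(u,w,v,\xi)=\mathcal L(u,w)$, attained at $v=v^*_{u,w}$, $\xi=0$. Hence (D) has the optimal value $\inf_{u\in\mathbb R^L_{\ge0},\,w\in\Delta^K}\mathcal L(u,w)$. 3. Suppose Slater's condition holds: some $\rho$ in the relative interior of $R$ satisfies $\sum_{(s,a)}c^{(l)}(s,a)\rho(s,a)\ge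 C^{(l)}$ for all $l$. Then the maximum in (P) and the minimum of $\mathcal L$ over $\mathbb R^L_{\ge0}\times\Delta^K$ are both attained, and they are equal to each other and to the optimal value of (D). -/

import Mathlib

open scoped BigOperators

/-- A multi-objective Markov decision process with finite state space `S`, finite action space `A`
and a reward vector with `K + L` components: the first `K` are the objectives of the max-min
criterion, the last `L` are the constrained ones. `trans s a s'` is `T(s' | s, a)`. -/
structure MOMDP (S A : Type*) [Fintype S] [Fintype A] (K L : ℕ) where
  trans : S → A → S → ℝ
  trans_mem : ∀ s a, trans s a ∈ stdSimplex ℝ S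
  init : S → ℝ
  init_mem : init ∈ stdSimplex ℝ S
  reward : S → A → Fin (K + L) → ℝ
  disc : ℝ
  disc_nonneg : 0 ≤ disc
  disc_lt_one : disc < 1

namespace MOMDP

variable {S A : Type*} [Fintype S] [Fintype A] {K L : ℕ}

/-- The objective `r^{(k)}(s, a)`, for `k` among the first `K` components. -/
def r (M : MOMDP S A K L) (k : Fin K) (s : S) (a : A) : ℝ := M.reward s a (Fin.castAdd L k)

/-- The constrained reward `c^{(l)}(s, a) = r^{(K + l)}(s, a)`. -/
def c (M : MOMDP S A K L) (l : Fin L) (s : S) (a : A) : ℝ := M.reward s a (Fin.natAdd K l)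

/-! ### The primal program over occupancy measures -/

/-- The policy induced by `ρ`: `π^ρ(a | s) = ρ(s, a) / ∑_{a'} ρ(s, a')`. (Where the state weight
`∑_{a'} ρ(s, a')` is zero the value is irrelevant: it is only used multiplied by that weight.) -/
noncomputable def inducedPolicy (ρ : S → A → ℝ) (s : S) (a : A) : ℝ := ρ s a / ∑ a', ρ s a'

/-- `∑_s H_ρ(s) ρ(s)`, where `H_ρ(s) = - ∑_a π^ρ(a | s) log π^ρ(a | s)` (with `0 log 0 = 0`)
and `ρ(s) = ∑_a ρ(s, a)`. -/
noncomputable def entropyTerm (ρ : S → A → ℝ) : ℝ :=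
  ∑ s, (∑ a, Real.negMulLog (inducedPolicy ρ s a)) * ∑ a, ρ s a

/-- The cumulative value `∑_{(s,a)} f(s, a) ρ(s, a)` of a scalar reward `f`. -/
def cumul (f : S → A → ℝ) (ρ : S → A → ℝ) : ℝ := ∑ s, ∑ a, f s a * ρ s a

/-- The right side of the Bellman flow equation at `s'`:
`μ₀(s') + γ ∑_{(s,a)} T(s' | s, a) ρ(s, a)`. -/
def inflow (M : MOMDP S A K L) (ρ : S → A → ℝ) (s' : S) : ℝ :=
  M.init s' + M.disc * ∑ s, ∑ a, M.trans s a s' * ρ s a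

/-- The set of occupancy measures: `ρ ≥ 0` subject to the Bellman flow equation. -/
def occupancySet (M : MOMDP S A K L) : Set (S → A → ℝ) :=
  {ρ | 0 ≤ ρ ∧ ∀ s', ∑ a', ρ s' a' = M.inflow ρ s'}

/-- The feasible set of the primal program: occupancy measures that satisfy the `L` constraints. -/
def feasibleSet (M : MOMDP S A K L) (C : Fin L → ℝ) : Set (S → A → ℝ) :=
  {ρ | ρ ∈ M.occupancySet ∧ ∀ l, C l ≤ cumul (M.c l) ρ}

/-- The primal objective: `min_k ∑ r^{(k)} ρ + β ∑_s H_ρ(s) ρ(s)` (a minimum over a finite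
index set, which is nonempty when `1 ≤ K`). -/
noncomputable def primalObj (M : MOMDP S A K L) (β : ℝ) (ρ : S → A → ℝ) : ℝ :=
  (⨅ k : Fin K, cumul (M.r k) ρ) + β * entropyTerm ρ

/-- Slater's condition in its form for affine inequality constraints: some feasible point lies in
the relative interior of the set of occupancy measures. -/
def Slater (M : MOMDP S A K L) (C : Fin L → ℝ) : Prop :=
  ∃ ρ ∈ intrinsicInterior ℝ M.occupancySet, ∀ l, C l ≤ cumul (M.c l) ρ

/-! ### The Lagrangian dual -/

/-- The Lagrangian of the primal program in epigraph form, which is to maximize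
`b + β ∑_s H_ρ(s) ρ(s)` over `(ρ, b)`, with the multipliers `u` (constraints `∑ c^{(l)} ρ ≥ C^{(l)}`),
`w` (constraints `∑ r^{(k)} ρ ≥ b`), `v` (flow equations) and `ξ` (constraints `ρ ≥ 0`). -/
noncomputable def lagrangian (M : MOMDP S A K L) (β : ℝ) (C : Fin L → ℝ)
    (u : Fin L → ℝ) (w : Fin K → ℝ) (v : S → ℝ) (ξ : S → A → ℝ) (ρ : S → A → ℝ) (b : ℝ) : ℝ :=
  b + β * entropyTerm ρ
    + ∑ k, w k * (cumul (M.r k) ρ - b)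
    + ∑ l, u l * (cumul (M.c l) ρ - C l)
    + ∑ s, v s * (M.inflow ρ s - ∑ a, ρ s a)
    + ∑ s, ∑ a, ξ s a * ρ s a

/-- The Lagrange dual function: the supremum of the Lagrangian over `b ∈ ℝ` and over `ρ` in the
domain `ρ ≥ 0` of the entropy. It may be infinite. -/
noncomputable def dualFun (M : MOMDP S A K L) (β : ℝ) (C : Fin L → ℝ)
    (u : Fin L → ℝ) (w : Fin K → ℝ) (v : S → ℝ) (ξ : S → A → ℝ) : EReal :=
  ⨆ (ρ : S → A → ℝ) (_ : 0 ≤ ρ) (b : ℝ), ((M.lagrangian β C u w v ξ ρ b : ℝ) : EReal)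

/-- The value of the dual problem: the infimum of the dual function over `u ≥ 0`, `w ≥ 0`, `ξ ≥ 0`
and arbitrary `v`. -/
noncomputable def dualValue (M : MOMDP S A K L) (β : ℝ) (C : Fin L → ℝ) : EReal :=
  ⨅ (u : Fin L → ℝ) (_ : 0 ≤ u) (w : Fin K → ℝ) (_ : 0 ≤ w) (v : S → ℝ)
    (ξ : S → A → ℝ) (_ : 0 ≤ ξ), M.dualFun β C u w v ξ

/-! ### The reduced program -/

/-- The soft Bellman operator `T_{u,w}`. -/
noncomputable def softBellman (M : MOMDP S A K L) (β : ℝ) (u : Fin L → ℝ) (w : Fin K → ℝ)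
    (v : S → ℝ) (s : S) : ℝ :=
  β * Real.log (∑ a, Real.exp (1 / β *
    (∑ l, u l * M.c l s a + ∑ k, w k * M.r k s a + M.disc * ∑ s', M.trans s a s' * v s')))

/-- The fixed point `v*_{u,w}` of the soft Bellman operator. (A choice of a fixed point; that there
is exactly one is a claim of the theorem.) -/
noncomputable def softValue (M : MOMDP S A K L) (β : ℝ) (u : Fin L → ℝ) (w : Fin K → ℝ) : S → ℝ :=
  Classical.epsilon fun v : S → ℝ => Function.IsFixedPt (M.softBellman β u w) v

/-- `ℒ(u, w) = ∑_s μ₀(s) v*_{u,w}(s) - ∑_l u_l C^{(l)}`. -/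
noncomputable def loss (M : MOMDP S A K L) (β : ℝ) (C : Fin L → ℝ)
    (p : (Fin L → ℝ) × (Fin K → ℝ)) : ℝ :=
  ∑ s, M.init s * M.softValue β p.1 p.2 s - ∑ l, p.1 l * C l

/-- The set `ℝ₊^L × Δ^K` of weights `(u, w)`. -/
def weightSet (K L : ℕ) : Set ((Fin L → ℝ) × (Fin K → ℝ)) :=
  Set.Ici 0 ×ˢ stdSimplex ℝ (Fin K)

end MOMDP

/-!
The Lagrangian splits over states. With `v` fixed, the state `s` contributes its Gibbs free energy
for the state-action values minus `v s`, times the mass of `s`; by the Gibbs variational inequality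
(`gibbs_le`, with equality at the softmax policy by `gibbs_softmax`) that contribution is at most
zero when `v` is the fixed point of the soft Bellman operator, which exists and is unique because
the operator is a contraction. So at `v = v*`, `ξ = 0` the supremum defining the dual function is
attained at `ρ = 0` and equals the loss. For any other `v` the occupancy measure of the softmax
policy gives at least the loss, since the flow equations eliminate `v`. In particular the loss is
the maximum over occupancy measures of the saddle function `MOMDP.saddle`, which is affine in the
weights; hence it is convex. The same statement for a process started at a single state gives the
convexity of `v*`, and continuity follows in finite dimension.

Strong duality uses neither concavity nor continuity of the entropy. A minimizer of the loss exists
by a penalization argument (`MOMDP.exists_min_loss`): along a recession direction, Slater's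
condition makes the constraint function vanish on the occupancy set, so the loss is constant and
one can move back. At a minimizer `p`, the directional first-order condition
(`MOMDP.loss_le_saddle_of_min`) shows that `p` and its soft-optimal occupancy measure `ρ` form a
saddle point; the soft-optimal measures vary continuously because they are the unique solutions of
the flow equations for a continuously varying softmax policy. Testing the saddle point inequality
on `u + e_l` yields feasibility of `ρ`, and on `(0, e_k)` with `k` a minimizing objective yields
that the primal objective at `ρ` reaches the loss.
-/

open Filter Topology

/-! ### Log-sum-exp and the Gibbs variational inequality -/

section LogSumExp

variable {A : Type*} [Fintype A]

/-- The scaled log-sum-exp function `q ↦ β log ∑_a exp (q a / β)`, a smooth maximum. -/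
noncomputable def logSumExp (β : ℝ) (q : A → ℝ) : ℝ :=
  β * Real.log (∑ a, Real.exp (1 / β * q a))

/-- The Gibbs weights `exp (q a / β) / ∑_b exp (q b / β)`, written with the logarithm of the
normalizing sum in the exponent. -/
noncomputable def softmax (β : ℝ) (q : A → ℝ) (a : A) : ℝ :=
  Real.exp (1 / β * (q a - logSumExp β q))

theorem sum_exp_pos [Nonempty A] (β : ℝ) (q : A → ℝ) : 0 < ∑ a, Real.exp (1 / β * q a) :=
  Finset.sum_pos (fun _ _ => Real.exp_pos _) Finset.univ_nonempty

theorem softmax_pos (β : ℝ) (q : A → ℝ) (a : A) : 0 < softmax β q a := Real.exp_pos _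

theorem sum_softmax [Nonempty A] {β : ℝ} (hβ : 0 < β) (q : A → ℝ) : ∑ a, softmax β q a = 1 := by
  have hZ := sum_exp_pos β q
  have h : ∀ a, softmax β q a
      = Real.exp (1 / β * q a) / ∑ b, Real.exp (1 / β * q b) := by
    intro a
    rw [softmax, logSumExp, mul_sub, ← mul_assoc, one_div_mul_cancel hβ.ne', one_mul, Real.exp_sub,
      Real.exp_log hZ]
  simp_rw [h, ← Finset.sum_div]
  exact div_self hZ.ne'

theorem logSumExp_mono_add [Nonempty A] {β : ℝ} (hβ : 0 < β) {q q' : A → ℝ} {δ : ℝ}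
    (h : ∀ a, q a ≤ q' a + δ) : logSumExp β q ≤ logSumExp β q' + δ := by
  have hZ := sum_exp_pos β q
  have hZ' := sum_exp_pos β q'
  have h1 : ∑ a, Real.exp (1 / β * q a) ≤ (∑ a, Real.exp (1 / β * q' a)) * Real.exp (1 / β * δ) := by
    rw [Finset.sum_mul]
    refine Finset.sum_le_sum fun a _ => ?_
    rw [← Real.exp_add, ← mul_add]
    exact Real.exp_le_exp.2 (mul_le_mul_of_nonneg_left (h a) (by positivity))
  have h2 := Real.log_le_log hZ h1
  rw [Real.log_mul hZ'.ne' (Real.exp_pos _).ne', Real.log_exp] at h2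
  have h3 := mul_le_mul_of_nonneg_left h2 hβ.le
  have h4 : β * (1 / β * δ) = δ := by field_simp
  rw [mul_add, h4] at h3
  exact h3

theorem sum_mul_add_negMulLog_le [Nonempty A] {β : ℝ} (hβ : 0 < β) (q p : A → ℝ) (hp : 0 ≤ p)
    (hp1 : ∑ a, p a = 1) :
    ∑ a, q a * p a + β * ∑ a, Real.negMulLog (p a) ≤ logSumExp β q := by
  have key : ∀ a, q a * p a + β * Real.negMulLog (p a) - logSumExp β q * p a
      ≤ β * (softmax β q a - p a) := by
    intro a
    rcases (hp a).eq_or_lt with h0 | h0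
    · simp only [Pi.zero_apply] at h0
      simp only [← h0, mul_zero, Real.negMulLog_zero, add_zero, sub_zero]
      exact mul_nonneg hβ.le (softmax_pos β q a).le
    · simp only [Pi.zero_apply] at h0
      have h1 := Real.log_le_sub_one_of_pos (div_pos (softmax_pos β q a) h0)
      rw [Real.log_div (softmax_pos β q a).ne' h0.ne', softmax, Real.log_exp] at h1
      have h2 := mul_le_mul_of_nonneg_left h1 (mul_pos hβ h0).le
      rw [Real.negMulLog]
      have e1 : β * p a * (1 / β * (q a - logSumExp β q) - Real.log (p a))
          = q a * p a + β * (-p a * Real.log (p a)) - logSumExp β q * p a := by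
        field_simp
        ring
      have e2 : β * p a * (Real.exp (1 / β * (q a - logSumExp β q)) / p a - 1)
          = β * (softmax β q a - p a) := by
        rw [softmax]
        field_simp
      linarith
  have h := Finset.sum_le_sum fun a (_ : a ∈ Finset.univ) => key a
  rw [← Finset.mul_sum, Finset.sum_sub_distrib, Finset.sum_sub_distrib, Finset.sum_add_distrib,
    ← Finset.mul_sum, ← Finset.mul_sum, sum_softmax hβ, hp1] at h
  linarith

/-- The Gibbs inequality in perspective form: a measure `x` on the actions of total mass `m` has
reward plus entropy at most `m` times the log-sum-exp. -/
theorem gibbs_le [Nonempty A] {β : ℝ} (hβ : 0 < β) (q x : A → ℝ) (hx : 0 ≤ x) :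
    ∑ a, q a * x a + β * ((∑ a, Real.negMulLog (x a / ∑ a', x a')) * ∑ a, x a)
      ≤ (∑ a, x a) * logSumExp β q := by
  have hm : 0 ≤ ∑ a, x a := Finset.sum_nonneg fun a _ => hx a
  rcases hm.eq_or_lt with h0 | h0
  · have hx0 : ∀ a, x a = 0 := fun a =>
      (Finset.sum_eq_zero_iff_of_nonneg fun a _ => hx a).1 h0.symm a (Finset.mem_univ a)
    simp [hx0]
  · have h := sum_mul_add_negMulLog_le hβ q (fun a => x a / ∑ a', x a')
      (fun a => div_nonneg (hx a) hm) (by rw [← Finset.sum_div, div_self h0.ne'])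
    have h' := mul_le_mul_of_nonneg_left h hm
    rw [mul_add, Finset.mul_sum] at h'
    have e : ∑ a, (∑ a', x a') * (q a * (x a / ∑ a', x a')) = ∑ a, q a * x a :=
      Finset.sum_congr rfl fun a _ => by field_simp
    rw [e] at h'
    linarith

theorem gibbs_softmax [Nonempty A] {β : ℝ} (hβ : 0 < β) (q x : A → ℝ)
    (hx : ∀ a, x a = (∑ a', x a') * softmax β q a) :
    ∑ a, q a * x a + β * ((∑ a, Real.negMulLog (x a / ∑ a', x a')) * ∑ a, x a)
      = (∑ a, x a) * logSumExp β q := by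
  generalize ∑ a', x a' = m at hx
  rcases eq_or_ne m 0 with h0 | h0
  · simp [hx, h0]
  · have h1 : ∀ a, x a / m = softmax β q a := fun a => by rw [hx a]; field_simp
    have h2 : ∀ a, β * Real.negMulLog (softmax β q a)
        = (logSumExp β q - q a) * softmax β q a := by
      intro a
      rw [Real.negMulLog, show Real.log (softmax β q a) = 1 / β * (q a - logSumExp β q) from
        Real.log_exp _]
      field_simp
      ring
    simp_rw [h1]
    rw [← mul_assoc, Finset.mul_sum]
    simp_rw [h2, sub_mul]
    rw [Finset.sum_sub_distrib, ← Finset.mul_sum, sum_softmax hβ]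
    have h3 : ∑ a, q a * x a = (∑ a, q a * softmax β q a) * m := by
      rw [Finset.sum_mul]
      exact Finset.sum_congr rfl fun a _ => by rw [hx a]; ring
    rw [h3]
    ring

end LogSumExp

/-! ### Discounted flow equations -/

section Flow

variable {S : Type*} [Fintype S]

theorem sum_abs_le_of_flow {γ : ℝ} (hγ : 0 ≤ γ) {P : S → S → ℝ} (hP : ∀ s s', 0 ≤ P s s')
    (hP1 : ∀ s, ∑ s', P s s' = 1) {b m : S → ℝ}
    (h : ∀ s', m s' = b s' + γ * ∑ s, m s * P s s') :
    (1 - γ) * ∑ s, |m s| ≤ ∑ s, |b s| := by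
  have h1 : ∀ s', |m s'| ≤ |b s'| + γ * ∑ s, |m s| * P s s' := by
    intro s'
    calc |m s'| = |b s' + γ * ∑ s, m s * P s s'| := by rw [← h s']
      _ ≤ |b s'| + |γ * ∑ s, m s * P s s'| := abs_add_le _ _
      _ ≤ |b s'| + γ * ∑ s, |m s| * P s s' := by
        rw [abs_mul, abs_of_nonneg hγ]
        gcongr
        refine (Finset.abs_sum_le_sum_abs _ _).trans_eq (Finset.sum_congr rfl fun s _ => ?_)
        rw [abs_mul, abs_of_nonneg (hP s s')]
  have h2 := Finset.sum_le_sum fun s' (_ : s' ∈ Finset.univ) => h1 s'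
  rw [Finset.sum_add_distrib, ← Finset.mul_sum, Finset.sum_comm] at h2
  simp_rw [← Finset.mul_sum, hP1, mul_one] at h2
  linarith

/-- The discounted flow equation of a Markov chain has a nonnegative solution. The equation is
solvable because the `ℓ¹` estimate makes `1 - γ Pᵀ` injective; the solution is nonnegative because
the same estimate bounds `∑ |m|` by `∑ m`. -/
theorem exists_flow {γ : ℝ} (hγ : 0 ≤ γ) (hγ1 : γ < 1) {P : S → S → ℝ}
    (hP : ∀ s s', 0 ≤ P s s') (hP1 : ∀ s, ∑ s', P s s' = 1) {b : S → ℝ} (hb : 0 ≤ b) :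
    ∃ m : S → ℝ, 0 ≤ m ∧ ∀ s', m s' = b s' + γ * ∑ s, m s * P s s' := by
  let F : (S → ℝ) →ₗ[ℝ] (S → ℝ) :=
    { toFun := fun m s' => m s' - γ * ∑ s, m s * P s s'
      map_add' := fun x y => by
        ext s'
        simp only [Pi.add_apply, add_mul, Finset.sum_add_distrib]
        ring
      map_smul' := fun t x => by
        ext s'
        simp only [Pi.smul_apply, smul_eq_mul, RingHom.id_apply, mul_assoc, ← Finset.mul_sum]
        ring }
  have hF : Function.Injective F := by
    rw [← LinearMap.ker_eq_bot, LinearMap.ker_eq_bot']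
    intro m hm
    have h := sum_abs_le_of_flow hγ hP hP1 (b := 0) (m := m) fun s' => by
      have := congrFun hm s'
      simp only [F, LinearMap.coe_mk, AddHom.coe_mk, Pi.zero_apply] at this
      simp only [Pi.zero_apply]
      linarith
    simp only [Pi.zero_apply, abs_zero, Finset.sum_const_zero] at h
    have h0 : ∑ s, |m s| = 0 := le_antisymm
      (nonpos_of_mul_nonpos_right h (by linarith)) (Finset.sum_nonneg fun s _ => abs_nonneg _)
    ext s
    exact abs_eq_zero.1
      ((Finset.sum_eq_zero_iff_of_nonneg fun s _ => abs_nonneg _).1 h0 s (Finset.mem_univ s))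
  obtain ⟨m, hm⟩ := LinearMap.injective_iff_surjective.1 hF b
  have hflow : ∀ s', m s' = b s' + γ * ∑ s, m s * P s s' := by
    intro s'
    have := congrFun hm s'
    simp only [F, LinearMap.coe_mk, AddHom.coe_mk] at this
    linarith
  refine ⟨m, fun s => ?_, hflow⟩
  have h1 := sum_abs_le_of_flow hγ hP hP1 hflow
  have h2 : ∑ s, m s = ∑ s, b s + γ * ∑ s, m s := by
    have h := Finset.sum_congr rfl fun s' (_ : s' ∈ Finset.univ) => hflow s'
    rw [Finset.sum_add_distrib, ← Finset.mul_sum, Finset.sum_comm] at h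
    simpa only [← Finset.mul_sum, hP1, mul_one] using h
  have h3 : ∑ s, |b s| = ∑ s, b s := Finset.sum_congr rfl fun s _ => abs_of_nonneg (hb s)
  have h4 : ∑ s, |m s| ≤ ∑ s, m s :=
    le_of_mul_le_mul_left (by linarith : (1 - γ) * _ ≤ (1 - γ) * _) (by linarith)
  have h5 : ∑ s, (|m s| - m s) = 0 := le_antisymm
    (by rw [Finset.sum_sub_distrib]; linarith)
    (Finset.sum_nonneg fun s _ => sub_nonneg.2 (le_abs_self _))
  have h6 := (Finset.sum_eq_zero_iff_of_nonneg fun s _ => sub_nonneg.2 (le_abs_self (m s))).1 h5 s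
    (Finset.mem_univ s)
  have h7 := abs_nonneg (m s)
  simp only [Pi.zero_apply]
  linarith

end Flow

namespace MOMDP

variable {S A : Type*} [Fintype S] [Fintype A] {K L : ℕ}

/-! ### The soft Bellman operator and its fixed point -/

/-- The state-action value `∑_l u_l c^{(l)} + ∑_k w_k r^{(k)} + γ ∑_{s'} T(s' | s, a) v(s')`. -/
def qValue (M : MOMDP S A K L) (u : Fin L → ℝ) (w : Fin K → ℝ) (v : S → ℝ) (s : S) (a : A) : ℝ :=
  ∑ l, u l * M.c l s a + ∑ k, w k * M.r k s a + M.disc * ∑ s', M.trans s a s' * v s'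

theorem softBellman_eq (M : MOMDP S A K L) (β : ℝ) (u : Fin L → ℝ) (w : Fin K → ℝ) (v : S → ℝ)
    (s : S) : M.softBellman β u w v s = logSumExp β (M.qValue u w v s) := rfl

theorem qValue_le_add_dist (M : MOMDP S A K L) (u : Fin L → ℝ) (w : Fin K → ℝ) (v v' : S → ℝ)
    (s : S) (a : A) : M.qValue u w v s a ≤ M.qValue u w v' s a + M.disc * dist v v' := by
  have h1 : ∑ s', M.trans s a s' * v s' ≤ ∑ s', M.trans s a s' * v' s' + dist v v' := by
    have : ∑ s', M.trans s a s' * v' s' + dist v v'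
        = ∑ s', M.trans s a s' * (v' s' + dist v v') := by
      simp_rw [mul_add]
      rw [Finset.sum_add_distrib, ← Finset.sum_mul, (M.trans_mem s a).2, one_mul]
    rw [this]
    refine Finset.sum_le_sum fun s' _ => mul_le_mul_of_nonneg_left ?_ ((M.trans_mem s a).1 s')
    have h2 := (le_abs_self _).trans ((Real.dist_eq _ _).symm.le.trans (dist_le_pi_dist v v' s'))
    linarith
  have h2 := mul_le_mul_of_nonneg_left h1 M.disc_nonneg
  simp only [qValue]
  linarith

theorem contracting_softBellman [Nonempty A] (M : MOMDP S A K L) {β : ℝ} (hβ : 0 < β)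
    (u : Fin L → ℝ) (w : Fin K → ℝ) :
    ContractingWith M.disc.toNNReal (M.softBellman β u w) := by
  refine ⟨?_, LipschitzWith.of_dist_le_mul fun v v' => ?_⟩
  · rw [← NNReal.coe_lt_coe, Real.coe_toNNReal _ M.disc_nonneg]
    exact M.disc_lt_one
  · rw [Real.coe_toNNReal _ M.disc_nonneg]
    refine (dist_pi_le_iff (mul_nonneg M.disc_nonneg dist_nonneg)).2 fun s => ?_
    have h1 := logSumExp_mono_add hβ (M.qValue_le_add_dist u w v v' s)
    have h2 := logSumExp_mono_add hβ (M.qValue_le_add_dist u w v' v s)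
    rw [dist_comm v' v] at h2
    rw [Real.dist_eq, abs_le, softBellman_eq, softBellman_eq]
    constructor <;> linarith

theorem isFixedPt_softValue [Nonempty A] (M : MOMDP S A K L) {β : ℝ} (hβ : 0 < β)
    (u : Fin L → ℝ) (w : Fin K → ℝ) :
    Function.IsFixedPt (M.softBellman β u w) (M.softValue β u w) :=
  Classical.epsilon_spec (p := fun v : S → ℝ => Function.IsFixedPt (M.softBellman β u w) v)
    ⟨_, (M.contracting_softBellman hβ u w).fixedPoint_isFixedPt⟩

theorem isFixedPt_softBellman_iff [Nonempty A] (M : MOMDP S A K L) {β : ℝ} (hβ : 0 < β)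
    (u : Fin L → ℝ) (w : Fin K → ℝ) (v : S → ℝ) :
    Function.IsFixedPt (M.softBellman β u w) v ↔ v = M.softValue β u w :=
  ⟨fun h => (M.contracting_softBellman hβ u w).fixedPoint_unique' h (M.isFixedPt_softValue hβ u w),
    fun h => h ▸ M.isFixedPt_softValue hβ u w⟩

theorem logSumExp_qValue_softValue [Nonempty A] (M : MOMDP S A K L) {β : ℝ} (hβ : 0 < β)
    (u : Fin L → ℝ) (w : Fin K → ℝ) (s : S) :
    logSumExp β (M.qValue u w (M.softValue β u w) s) = M.softValue β u w s :=
  congrFun (M.isFixedPt_softValue hβ u w) s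

/-! ### The saddle function -/

/-- The Lagrangian of the primal program restricted to occupancy measures and, after elimination of
the epigraph variable, to weights `w` of sum one: `∑_k w_k r^{(k)}(ρ) + ∑_l u_l (c^{(l)}(ρ) - C_l)`
plus the entropy term. It is affine in `p = (u, w)`. -/
noncomputable def saddle (M : MOMDP S A K L) (β : ℝ) (C : Fin L → ℝ)
    (p : (Fin L → ℝ) × (Fin K → ℝ)) (ρ : S → A → ℝ) : ℝ :=
  ∑ k, p.2 k * cumul (M.r k) ρ + ∑ l, p.1 l * (cumul (M.c l) ρ - C l) + β * entropyTerm ρ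

theorem saddle_combo (M : MOMDP S A K L) (β : ℝ) (C : Fin L → ℝ)
    (p q : (Fin L → ℝ) × (Fin K → ℝ)) (ρ : S → A → ℝ) {x y : ℝ} (hxy : x + y = 1) :
    M.saddle β C (x • p + y • q) ρ = x * M.saddle β C p ρ + y * M.saddle β C q ρ := by
  simp only [saddle, Prod.fst_add, Prod.snd_add, Prod.smul_fst, Prod.smul_snd, Pi.add_apply,
    Pi.smul_apply, smul_eq_mul, add_mul, Finset.sum_add_distrib, mul_assoc, ← Finset.mul_sum]
  linear_combination (-β * entropyTerm ρ) * hxy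

theorem lagrangian_eq (M : MOMDP S A K L) (β : ℝ) (C : Fin L → ℝ) (u : Fin L → ℝ) (w : Fin K → ℝ)
    (v : S → ℝ) (ξ ρ : S → A → ℝ) (b : ℝ) :
    M.lagrangian β C u w v ξ ρ b = M.saddle β C (u, w) ρ + b * (1 - ∑ k, w k)
      + ∑ s, v s * (M.inflow ρ s - ∑ a, ρ s a) + ∑ s, ∑ a, ξ s a * ρ s a := by
  simp only [lagrangian, saddle, mul_sub, Finset.sum_sub_distrib, ← Finset.sum_mul]
  ring

theorem sum_sum_mul_cumul {ι : Type*} [Fintype ι] (u : ι → ℝ) (f : ι → S → A → ℝ)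
    (ρ : S → A → ℝ) :
    ∑ s, ∑ a, (∑ i, u i * f i s a) * ρ s a = ∑ i, u i * cumul (f i) ρ := by
  simp only [cumul, Finset.mul_sum, Finset.sum_mul, mul_assoc]
  rw [Finset.sum_comm (s := (Finset.univ : Finset ι))]
  exact Finset.sum_congr rfl fun s _ => Finset.sum_comm

/-- Collecting the terms of the Lagrangian state by state: the state `s` contributes its
`qValue`-reward and entropy, less `v s` times its mass. -/
theorem saddle_add_flow_eq (M : MOMDP S A K L) (β : ℝ) (C : Fin L → ℝ) (u : Fin L → ℝ)
    (w : Fin K → ℝ) (v : S → ℝ) (ρ : S → A → ℝ) :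
    M.saddle β C (u, w) ρ + ∑ s, v s * (M.inflow ρ s - ∑ a, ρ s a)
      = ∑ s, ((∑ a, M.qValue u w v s a * ρ s a
          + β * ((∑ a, Real.negMulLog (ρ s a / ∑ a', ρ s a')) * ∑ a, ρ s a))
          - (∑ a, ρ s a) * v s)
        + (∑ s, M.init s * v s - ∑ l, u l * C l) := by
  have e3 : ∑ s, ∑ a, (∑ s', M.trans s a s' * v s') * ρ s a
      = ∑ s', v s' * ∑ s, ∑ a, M.trans s a s' * ρ s a := by
    have h := sum_sum_mul_cumul v (fun s' s a => M.trans s a s') ρ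
    simp_rw [mul_comm (v _) (M.trans _ _ _)] at h
    exact h
  have e4 : ∑ s, ∑ a, M.qValue u w v s a * ρ s a = ∑ l, u l * cumul (M.c l) ρ
      + ∑ k, w k * cumul (M.r k) ρ
      + M.disc * ∑ s', v s' * ∑ s, ∑ a, M.trans s a s' * ρ s a := by
    rw [← e3, ← sum_sum_mul_cumul, ← sum_sum_mul_cumul]
    simp only [qValue, add_mul, Finset.sum_add_distrib, mul_assoc, ← Finset.mul_sum]
  have e5 : ∑ s, v s * (M.inflow ρ s - ∑ a, ρ s a) = ∑ s, M.init s * v s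
      + M.disc * (∑ s', v s' * ∑ s, ∑ a, M.trans s a s' * ρ s a)
      - ∑ s, (∑ a, ρ s a) * v s := by
    rw [Finset.mul_sum, ← Finset.sum_add_distrib, ← Finset.sum_sub_distrib]
    exact Finset.sum_congr rfl fun s _ => by rw [inflow]; ring
  rw [Finset.sum_sub_distrib, Finset.sum_add_distrib, ← Finset.mul_sum, e4, e5]
  simp only [saddle, entropyTerm, inducedPolicy, mul_sub, Finset.sum_sub_distrib]
  ring

/-! ### The dual function -/

theorem saddle_add_flow_le_loss [Nonempty A] (M : MOMDP S A K L) {β : ℝ} (hβ : 0 < β)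
    (C : Fin L → ℝ) (u : Fin L → ℝ) (w : Fin K → ℝ) {ρ : S → A → ℝ} (hρ : 0 ≤ ρ) :
    M.saddle β C (u, w) ρ + ∑ s, M.softValue β u w s * (M.inflow ρ s - ∑ a, ρ s a)
      ≤ M.loss β C (u, w) := by
  rw [saddle_add_flow_eq, loss]
  refine add_le_of_nonpos_left (Finset.sum_nonpos fun s _ => ?_)
  have h := gibbs_le hβ (M.qValue u w (M.softValue β u w) s) (ρ s) (hρ s)
  rw [M.logSumExp_qValue_softValue hβ] at h
  linarith

theorem saddle_le_loss [Nonempty A] (M : MOMDP S A K L) {β : ℝ} (hβ : 0 < β) (C : Fin L → ℝ)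
    (p : (Fin L → ℝ) × (Fin K → ℝ)) {ρ : S → A → ℝ} (hρ : ρ ∈ M.occupancySet) :
    M.saddle β C p ρ ≤ M.loss β C p := by
  have h := M.saddle_add_flow_le_loss hβ C p.1 p.2 hρ.1
  simpa [hρ.2] using h

/-- `ρ` follows the softmax policy of the soft Bellman fixed point for the weights `p`. -/
def IsSoftOptimal (M : MOMDP S A K L) (β : ℝ) (p : (Fin L → ℝ) × (Fin K → ℝ))
    (ρ : S → A → ℝ) : Prop :=
  ∀ s a, ρ s a = (∑ a', ρ s a') * softmax β (M.qValue p.1 p.2 (M.softValue β p.1 p.2) s) a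

theorem IsSoftOptimal.saddle_eq_loss [Nonempty A] {M : MOMDP S A K L} {β : ℝ} (hβ : 0 < β)
    (C : Fin L → ℝ) {p : (Fin L → ℝ) × (Fin K → ℝ)} {ρ : S → A → ℝ} (hρ : ρ ∈ M.occupancySet)
    (h : M.IsSoftOptimal β p ρ) : M.saddle β C p ρ = M.loss β C p := by
  have h1 := M.saddle_add_flow_eq β C p.1 p.2 (M.softValue β p.1 p.2) ρ
  have h2 : ∀ s, _ := fun s => gibbs_softmax hβ _ (ρ s) (h s)
  simp_rw [h2, M.logSumExp_qValue_softValue hβ] at h1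
  simpa [hρ.2, loss] using h1

theorem exists_isSoftOptimal [Nonempty A] (M : MOMDP S A K L) {β : ℝ} (hβ : 0 < β)
    (p : (Fin L → ℝ) × (Fin K → ℝ)) : ∃ ρ ∈ M.occupancySet, M.IsSoftOptimal β p ρ := by
  let π := fun s => softmax β (M.qValue p.1 p.2 (M.softValue β p.1 p.2) s)
  have hπ1 : ∀ s, ∑ a, π s a = 1 := fun s => sum_softmax hβ _
  obtain ⟨m, hm, hflow⟩ := exists_flow M.disc_nonneg M.disc_lt_one
    (P := fun s s' => ∑ a, π s a * M.trans s a s')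
    (fun s s' => Finset.sum_nonneg fun a _ =>
      mul_nonneg (softmax_pos β _ a).le ((M.trans_mem s a).1 s'))
    (fun s => by
      rw [Finset.sum_comm]
      simp_rw [← Finset.mul_sum, (M.trans_mem s _).2, mul_one]
      exact hπ1 s) M.init_mem.1
  have hsum : ∀ s, ∑ a, m s * π s a = m s := fun s => by rw [← Finset.mul_sum, hπ1, mul_one]
  refine ⟨fun s a => m s * π s a, ⟨fun s a => mul_nonneg (hm s) (softmax_pos β _ a).le,
    fun s' => ?_⟩, fun s a => congrArg (· * π s a) (hsum s).symm⟩
  rw [hsum, inflow, hflow s']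
  simp_rw [Finset.mul_sum]
  refine congrArg _ (Finset.sum_congr rfl fun s _ => Finset.sum_congr rfl fun a _ => by ring)

theorem lagrangian_le_dualFun (M : MOMDP S A K L) (β : ℝ) (C : Fin L → ℝ) (u : Fin L → ℝ)
    (w : Fin K → ℝ) (v : S → ℝ) (ξ : S → A → ℝ) {ρ : S → A → ℝ} (hρ : 0 ≤ ρ) (b : ℝ) :
    ((M.lagrangian β C u w v ξ ρ b : ℝ) : EReal) ≤ M.dualFun β C u w v ξ :=
  le_iSup₂_of_le ρ hρ (le_iSup_of_le b le_rfl)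

/-- If the weights `w` do not sum to one, the epigraph variable makes the Lagrangian unbounded. -/
theorem dualFun_eq_top (M : MOMDP S A K L) (β : ℝ) (C : Fin L → ℝ) (u : Fin L → ℝ)
    {w : Fin K → ℝ} (hw : 0 ≤ w) (hw1 : w ∉ stdSimplex ℝ (Fin K)) (v : S → ℝ) (ξ : S → A → ℝ) :
    M.dualFun β C u w v ξ = ⊤ := by
  have h1 : 1 - ∑ k, w k ≠ 0 := fun h => hw1 ⟨hw, by linarith⟩
  rw [EReal.eq_top_iff_forall_lt]
  intro y
  have h2 := M.lagrangian_le_dualFun β C u w v ξ le_rfl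
    ((y + 1 - M.lagrangian β C u w v ξ 0 0) / (1 - ∑ k, w k))
  refine lt_of_lt_of_le (EReal.coe_lt_coe_iff.2 ?_) h2
  rw [lagrangian_eq, div_mul_cancel₀ _ h1, lagrangian_eq]
  linarith

theorem dualFun_softValue [Nonempty A] (M : MOMDP S A K L) {β : ℝ} (hβ : 0 < β) (C : Fin L → ℝ)
    (u : Fin L → ℝ) {w : Fin K → ℝ} (hw : w ∈ stdSimplex ℝ (Fin K)) :
    M.dualFun β C u w (M.softValue β u w) 0 = ((M.loss β C (u, w) : ℝ) : EReal) := by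
  apply le_antisymm
  · refine iSup₂_le fun ρ hρ => iSup_le fun b => EReal.coe_le_coe_iff.2 ?_
    have h := M.saddle_add_flow_le_loss hβ C u w hρ
    rw [lagrangian_eq, hw.2]
    simpa using h
  · -- the supremum is attained at `ρ = 0`, `b = 0`
    refine le_trans (EReal.coe_le_coe_iff.2 (le_of_eq ?_))
      (M.lagrangian_le_dualFun β C u w (M.softValue β u w) 0 le_rfl 0)
    have h := M.saddle_add_flow_eq β C u w (M.softValue β u w) 0
    rw [lagrangian_eq, loss]
    simp only [Pi.zero_apply, mul_zero, Finset.sum_const_zero, zero_mul, add_zero, sub_zero,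
      zero_add] at h ⊢
    exact h.symm

theorem loss_le_dualFun [Nonempty A] (M : MOMDP S A K L) {β : ℝ} (hβ : 0 < β) (C : Fin L → ℝ)
    (u : Fin L → ℝ) (w : Fin K → ℝ) (v : S → ℝ) {ξ : S → A → ℝ} (hξ : 0 ≤ ξ) :
    ((M.loss β C (u, w) : ℝ) : EReal) ≤ M.dualFun β C u w v ξ := by
  -- on an occupancy measure the multipliers `v` of the flow equations drop out
  obtain ⟨ρ, hρ, hopt⟩ := M.exists_isSoftOptimal hβ (u, w)
  refine le_trans (EReal.coe_le_coe_iff.2 ?_) (M.lagrangian_le_dualFun β C u w v ξ hρ.1 0)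
  rw [lagrangian_eq, hopt.saddle_eq_loss hβ C hρ]
  have h : 0 ≤ ∑ s, ∑ a, ξ s a * ρ s a :=
    Finset.sum_nonneg fun s _ => Finset.sum_nonneg fun a _ => mul_nonneg (hξ s a) (hρ.1 s a)
  simpa [hρ.2] using h

theorem dualValue_eq [Nonempty A] (M : MOMDP S A K L) {β : ℝ} (hβ : 0 < β) (C : Fin L → ℝ) :
    M.dualValue β C = ⨅ p ∈ weightSet K L, ((M.loss β C p : ℝ) : EReal) := by
  apply le_antisymm
  · refine le_iInf₂ fun p hp => ?_
    rw [← M.dualFun_softValue hβ C p.1 hp.2]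
    exact iInf₂_le_of_le p.1 hp.1 (iInf₂_le_of_le p.2 hp.2.1
      (iInf_le_of_le _ (iInf₂_le_of_le 0 le_rfl le_rfl)))
  · refine le_iInf₂ fun u hu => le_iInf₂ fun w hw => le_iInf fun v => le_iInf₂ fun ξ hξ => ?_
    by_cases hw1 : w ∈ stdSimplex ℝ (Fin K)
    · exact iInf₂_le_of_le (u, w) ⟨hu, hw1⟩ (M.loss_le_dualFun hβ C u w v hξ)
    · rw [M.dualFun_eq_top β C u hw hw1]
      exact le_top

/-! ### Convexity and continuity -/

theorem convexOn_loss_univ [Nonempty A] (M : MOMDP S A K L) {β : ℝ} (hβ : 0 < β)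
    (C : Fin L → ℝ) : ConvexOn ℝ Set.univ (M.loss β C) := by
  refine ⟨convex_univ, fun p _ q _ x y hx hy hxy => ?_⟩
  obtain ⟨ρ, hρ, hopt⟩ := M.exists_isSoftOptimal hβ (x • p + y • q)
  rw [← hopt.saddle_eq_loss hβ C hρ, M.saddle_combo β C p q ρ hxy]
  exact add_le_add (mul_le_mul_of_nonneg_left (M.saddle_le_loss hβ C p hρ) hx)
    (mul_le_mul_of_nonneg_left (M.saddle_le_loss hβ C q hρ) hy)

/-- The soft value at `s` is the loss, without constraint terms, of the process started at `s`. -/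
theorem convexOn_softValue [Nonempty A] (M : MOMDP S A K L) {β : ℝ} (hβ : 0 < β) (s : S) :
    ConvexOn ℝ Set.univ
      fun p : (Fin L → ℝ) × (Fin K → ℝ) => M.softValue β p.1 p.2 s := by
  classical
  have h := convexOn_loss_univ
    { M with init := Pi.single s 1, init_mem := single_mem_stdSimplex ℝ s } hβ 0
  refine h.congr fun p _ => ?_
  simp only [loss, Pi.single_apply, ite_mul, one_mul, zero_mul, Finset.sum_ite_eq',
    Finset.mem_univ, if_true, Pi.zero_apply, mul_zero, Finset.sum_const_zero, sub_zero]
  rfl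

theorem continuous_softValue [Nonempty A] (M : MOMDP S A K L) {β : ℝ} (hβ : 0 < β) :
    Continuous fun p : (Fin L → ℝ) × (Fin K → ℝ) => M.softValue β p.1 p.2 :=
  continuous_pi fun s =>
    continuousOn_univ.1 ((M.convexOn_softValue hβ s).continuousOn isOpen_univ)

theorem continuous_loss [Nonempty A] (M : MOMDP S A K L) {β : ℝ} (hβ : 0 < β) (C : Fin L → ℝ) :
    Continuous (M.loss β C) :=
  continuousOn_univ.1 ((M.convexOn_loss_univ hβ C).continuousOn isOpen_univ)

theorem convex_weightSet (K L : ℕ) : Convex ℝ (weightSet K L) :=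
  (convex_Ici 0).prod (convex_stdSimplex ℝ _)

/-! ### The set of occupancy measures -/

theorem continuous_cumul (f : S → A → ℝ) : Continuous (cumul f) := by
  unfold cumul
  fun_prop

theorem continuous_inflow (M : MOMDP S A K L) (s' : S) : Continuous fun ρ => M.inflow ρ s' := by
  unfold inflow
  fun_prop

theorem isClosed_occupancySet (M : MOMDP S A K L) : IsClosed M.occupancySet := by
  have h : M.occupancySet = Set.Ici 0 ∩ ⋂ s', {ρ | ∑ a', ρ s' a' = M.inflow ρ s'} := by
    ext ρ
    simp [occupancySet]
  rw [h]
  exact isClosed_Ici.inter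
    (isClosed_iInter fun s' => isClosed_eq (by fun_prop) (M.continuous_inflow s'))

theorem sum_eq_of_mem_occupancySet (M : MOMDP S A K L) {ρ : S → A → ℝ}
    (hρ : ρ ∈ M.occupancySet) : (1 - M.disc) * ∑ s, ∑ a, ρ s a = 1 := by
  have h : ∑ s', ∑ a, ρ s' a = ∑ s', M.inflow ρ s' := Finset.sum_congr rfl fun s' _ => hρ.2 s'
  have h2 : ∑ s', ∑ s, ∑ a, M.trans s a s' * ρ s a = ∑ s, ∑ a, ρ s a := by
    rw [Finset.sum_comm]
    refine Finset.sum_congr rfl fun s _ => ?_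
    rw [Finset.sum_comm]
    simp_rw [← Finset.sum_mul, (M.trans_mem s _).2, one_mul]
  simp only [inflow, Finset.sum_add_distrib, ← Finset.mul_sum, M.init_mem.2, h2] at h
  linarith

theorem isCompact_occupancySet (M : MOMDP S A K L) : IsCompact M.occupancySet := by
  refine (isCompact_Icc (a := (0 : S → A → ℝ)) (b := fun _ _ => 1 / (1 - M.disc))).of_isClosed_subset
    M.isClosed_occupancySet fun ρ hρ => ⟨hρ.1, fun s a => ?_⟩
  have h0 : 0 < 1 - M.disc := sub_pos.2 M.disc_lt_one
  rw [le_div_iff₀' h0]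
  refine le_of_le_of_eq (mul_le_mul_of_nonneg_left ?_ h0.le) (M.sum_eq_of_mem_occupancySet hρ)
  calc ρ s a ≤ ∑ a, ρ s a :=
        Finset.single_le_sum (fun a _ => hρ.1 s a) (Finset.mem_univ a)
    _ ≤ ∑ s, ∑ a, ρ s a := Finset.single_le_sum (f := fun s => ∑ a, ρ s a)
        (fun s _ => Finset.sum_nonneg fun a _ => hρ.1 s a) (Finset.mem_univ s)

end MOMDP

/-! ### Attainment in the reduced program -/

/-- From a point of the relative interior one can move a little away from any point of the set. -/
theorem exists_add_smul_sub_mem_of_mem_intrinsicInterior {E : Type*} [AddCommGroup E] [Module ℝ E]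
    [TopologicalSpace E] [IsTopologicalAddGroup E] [ContinuousSMul ℝ E] {s : Set E} {x y : E}
    (hx : x ∈ intrinsicInterior ℝ s) (hy : y ∈ s) : ∃ δ : ℝ, 0 < δ ∧ x + δ • (x - y) ∈ s := by
  obtain ⟨z, hz, rfl⟩ := mem_intrinsicInterior.1 hx
  let φ : ℝ → affineSpan ℝ s := fun t =>
    ⟨AffineMap.lineMap (z : E) y (-t), AffineMap.lineMap_mem _ z.2 (subset_affineSpan ℝ s hy)⟩
  have hφ : Continuous φ := by
    refine Continuous.subtype_mk ?_ _
    simp only [AffineMap.lineMap_apply_module']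
    fun_prop
  have h0 : φ 0 = z := by simp [φ]
  have h1 : ∀ᶠ t in 𝓝[>] (0 : ℝ), φ t ∈ ((↑) ⁻¹' s : Set (affineSpan ℝ s)) :=
    (hφ.tendsto 0).mono_left nhdsWithin_le_nhds
      (by rw [h0]; exact mem_interior_iff_mem_nhds.1 hz)
  obtain ⟨t, ht, ht0⟩ := (h1.and self_mem_nhdsWithin).exists
  refine ⟨t, ht0, ?_⟩
  have h2 : ((φ t : affineSpan ℝ s) : E) = z + t • ((z : E) - y) := by
    simp only [φ, AffineMap.lineMap_apply_module', smul_sub, neg_smul]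
    abel
  rw [← h2]
  exact ht

namespace MOMDP

variable {S A : Type*} [Fintype S] [Fintype A] {K L : ℕ}

theorem primalObj_le_of_mem_stdSimplex (M : MOMDP S A K L) (β : ℝ) {w : Fin K → ℝ}
    (hw : w ∈ stdSimplex ℝ (Fin K)) (ρ : S → A → ℝ) :
    M.primalObj β ρ ≤ ∑ k, w k * cumul (M.r k) ρ + β * entropyTerm ρ := by
  refine add_le_add ?_ le_rfl
  calc (⨅ k : Fin K, cumul (M.r k) ρ) = ∑ k, w k * ⨅ k : Fin K, cumul (M.r k) ρ := by
        rw [← Finset.sum_mul, hw.2, one_mul]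
    _ ≤ _ := Finset.sum_le_sum fun k _ => mul_le_mul_of_nonneg_left
        (ciInf_le (Set.finite_range _).bddBelow k) (hw.1 k)

theorem primalObj_le_loss [Nonempty A] (M : MOMDP S A K L) {β : ℝ} (hβ : 0 < β) (C : Fin L → ℝ)
    {ρ : S → A → ℝ} (hρ : ρ ∈ M.feasibleSet C) {p : (Fin L → ℝ) × (Fin K → ℝ)}
    (hp : p ∈ weightSet K L) : M.primalObj β ρ ≤ M.loss β C p := by
  refine le_trans ?_ (M.saddle_le_loss hβ C p hρ.1)
  have h1 := M.primalObj_le_of_mem_stdSimplex β hp.2 ρ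
  have h2 : 0 ≤ ∑ l, p.1 l * (cumul (M.c l) ρ - C l) :=
    Finset.sum_nonneg fun l _ => mul_nonneg (hp.1 l) (sub_nonneg.2 (hρ.2 l))
  rw [saddle]
  linarith

theorem cumul_add_smul_sub (f : S → A → ℝ) (ρ ρ' : S → A → ℝ) (t : ℝ) :
    cumul f (ρ + t • (ρ - ρ')) = cumul f ρ + t * (cumul f ρ - cumul f ρ') := by
  simp only [cumul, ← Finset.sum_sub_distrib, Finset.mul_sum, ← Finset.sum_add_distrib]
  refine Finset.sum_congr rfl fun s _ => Finset.sum_congr rfl fun a _ => ?_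
  simp only [Pi.add_apply, Pi.smul_apply, Pi.sub_apply, smul_eq_mul]
  ring

/-- Under Slater's condition, a direction `d ≥ 0` along which the loss stays bounded above is one
along which it is constant: the affine function `d · (c(ρ) - C)` is nonpositive on the occupancy
set and nonnegative at a relative interior point, so it vanishes identically. -/
theorem Slater.sum_mul_eq_zero {M : MOMDP S A K L} {C : Fin L → ℝ} (hS : M.Slater C)
    {d : Fin L → ℝ} (hd : 0 ≤ d)
    (h : ∀ ρ ∈ M.occupancySet, ∑ l, d l * (cumul (M.c l) ρ - C l) ≤ 0) :
    ∀ ρ ∈ M.occupancySet, ∑ l, d l * (cumul (M.c l) ρ - C l) = 0 := by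
  obtain ⟨ρ₀, hρ₀, hC⟩ := hS
  intro ρ hρ
  obtain ⟨δ, hδ, hmem⟩ := exists_add_smul_sub_mem_of_mem_intrinsicInterior hρ₀ hρ
  have h1 := h _ hmem
  have h2 : 0 ≤ ∑ l, d l * (cumul (M.c l) ρ₀ - C l) :=
    Finset.sum_nonneg fun l _ => mul_nonneg (hd l) (sub_nonneg.2 (hC l))
  have h3 : ∑ l, d l * (cumul (M.c l) (ρ₀ + δ • (ρ₀ - ρ)) - C l)
      = (1 + δ) * ∑ l, d l * (cumul (M.c l) ρ₀ - C l)
        - δ * ∑ l, d l * (cumul (M.c l) ρ - C l) := by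
    rw [Finset.mul_sum, Finset.mul_sum, ← Finset.sum_sub_distrib]
    refine Finset.sum_congr rfl fun l _ => ?_
    rw [cumul_add_smul_sub]
    ring
  have h4 := h ρ hρ
  rw [h3] at h1
  nlinarith [mul_nonneg hδ.le (neg_nonneg.2 h4), mul_nonneg hδ.le h2]

theorem loss_sub_le [Nonempty A] (M : MOMDP S A K L) {β : ℝ} (hβ : 0 < β) {C : Fin L → ℝ}
    {d : Fin L → ℝ} (h : ∀ ρ ∈ M.occupancySet, ∑ l, d l * (cumul (M.c l) ρ - C l) = 0)
    (u : Fin L → ℝ) (w : Fin K → ℝ) : M.loss β C (u - d, w) ≤ M.loss β C (u, w) := by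
  obtain ⟨ρ, hρ, hopt⟩ := M.exists_isSoftOptimal hβ (u - d, w)
  rw [← hopt.saddle_eq_loss hβ C hρ]
  refine le_of_eq_of_le ?_ (M.saddle_le_loss hβ C (u, w) hρ)
  have h1 := h ρ hρ
  simp only [saddle, Pi.sub_apply, sub_mul, Finset.sum_sub_distrib, h1, sub_zero]

/-- The penalized loss `ℒ(u, w) + ε ∑_l u_l` has a minimizer, since `ℒ` is bounded below by the
primal objective at any feasible point. -/
theorem exists_min_loss_add [Nonempty A] (hK : 1 ≤ K) (M : MOMDP S A K L) {β : ℝ} (hβ : 0 < β)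
    (C : Fin L → ℝ) (hne : (M.feasibleSet C).Nonempty) {ε : ℝ} (hε : 0 < ε) :
    ∃ p ∈ weightSet K L, ∀ q ∈ weightSet K L,
      M.loss β C p + ε * ∑ l, p.1 l ≤ M.loss β C q + ε * ∑ l, q.1 l := by
  obtain ⟨ρ, hρ⟩ := hne
  have hw₀ : Pi.single ⟨0, hK⟩ 1 ∈ stdSimplex ℝ (Fin K) := single_mem_stdSimplex ℝ _
  set p₀ : (Fin L → ℝ) × (Fin K → ℝ) := (0, Pi.single ⟨0, hK⟩ 1) with hp₀
  have hp₀W : p₀ ∈ weightSet K L := ⟨Set.mem_Ici.2 le_rfl, hw₀⟩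
  set B := (M.loss β C p₀ - M.primalObj β ρ) / ε with hB
  have hB0 : 0 ≤ B := div_nonneg (sub_nonneg.2 (M.primalObj_le_loss hβ C hρ hp₀W)) hε.le
  have hcpt : IsCompact (Set.Icc (0 : Fin L → ℝ) (fun _ => B) ×ˢ stdSimplex ℝ (Fin K)) :=
    isCompact_Icc.prod (isCompact_stdSimplex ℝ _)
  have hcont : Continuous fun p : (Fin L → ℝ) × (Fin K → ℝ) =>
      M.loss β C p + ε * ∑ l, p.1 l := by
    have := M.continuous_loss hβ C
    fun_prop
  obtain ⟨p, hp, hmin⟩ := hcpt.exists_isMinOn ⟨p₀, ⟨le_rfl, fun _ => hB0⟩, hw₀⟩ hcont.continuousOn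
  refine ⟨p, ⟨hp.1.1, hp.2⟩, fun q hq => ?_⟩
  by_cases hqB : ∀ l, q.1 l ≤ B
  · exact hmin ⟨⟨hq.1, hqB⟩, hq.2⟩
  · obtain ⟨l, hl⟩ := not_forall.1 hqB
    have h1 : M.loss β C p + ε * ∑ l, p.1 l ≤ M.loss β C p₀ := by
      have : M.loss β C p + ε * ∑ l, p.1 l ≤ M.loss β C p₀ + ε * ∑ l, p₀.1 l :=
        hmin ⟨⟨le_rfl, fun _ => hB0⟩, hw₀⟩
      simpa [hp₀] using this
    have h2 : B ≤ ∑ l, q.1 l := (not_le.1 hl).le.trans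
      (Finset.single_le_sum (fun l _ => hq.1 l) (Finset.mem_univ l))
    have h3 := mul_le_mul_of_nonneg_left h2 hε.le
    rw [hB, mul_div_cancel₀ _ hε.ne'] at h3
    have h4 := M.primalObj_le_loss hβ C hρ hq
    linarith

/-- Under Slater's condition the reduced program has a minimizer. Minimizers of the penalized loss
are followed as the penalty tends to zero. If they stay bounded along a subsequence, they converge
to a minimizer of the loss. Otherwise they escape along a recession direction `d ≥ 0`, along which
the loss is constant; subtracting `d` then keeps the loss and decreases the penalty, which
contradicts minimality. -/
theorem exists_min_loss [Nonempty A] (hK : 1 ≤ K) (M : MOMDP S A K L) {β : ℝ} (hβ : 0 < β)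
    {C : Fin L → ℝ} (hS : M.Slater C) :
    ∃ p ∈ weightSet K L, ∀ q ∈ weightSet K L, M.loss β C p ≤ M.loss β C q := by
  have hne : (M.feasibleSet C).Nonempty :=
    let ⟨ρ, hρ, hC⟩ := hS
    ⟨ρ, intrinsicInterior_subset hρ, hC⟩
  let ε : ℕ → ℝ := fun n => 1 / ((n : ℝ) + 1)
  have hε : ∀ n, 0 < ε n := fun n => Nat.one_div_pos_of_nat
  have hε0 : Tendsto ε atTop (𝓝 0) := tendsto_one_div_add_atTop_nhds_zero_nat
  choose p hpW hpmin using fun n => M.exists_min_loss_add hK hβ C hne (hε n)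
  have hsum : ∀ n, 0 ≤ ∑ l, (p n).1 l := fun n => Finset.sum_nonneg fun l _ => (hpW n).1 l
  have hle : ∀ n, ∀ q ∈ weightSet K L, M.loss β C (p n) ≤ M.loss β C q + ε n * ∑ l, q.1 l :=
    fun n q hq => (le_add_of_nonneg_right (mul_nonneg (hε n).le (hsum n))).trans (hpmin n q hq)
  by_cases hT : Tendsto (fun n => ∑ l, (p n).1 l) atTop atTop
  · exfalso
    have hw₀ : Pi.single ⟨0, hK⟩ 1 ∈ stdSimplex ℝ (Fin K) := single_mem_stdSimplex ℝ _
    set p₀ : (Fin L → ℝ) × (Fin K → ℝ) := (0, Pi.single ⟨0, hK⟩ 1) with hp₀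
    have hle₀ : ∀ n, M.loss β C (p n) ≤ M.loss β C p₀ := fun n => by
      simpa [hp₀] using hle n p₀ ⟨Set.mem_Ici.2 le_rfl, hw₀⟩
    have hpos : ∀ᶠ n in atTop, 0 < ∑ l, (p n).1 l := hT.eventually_gt_atTop 0
    obtain ⟨d, hd, φ, hφ, hlim⟩ := (isCompact_stdSimplex ℝ (Fin L)).tendsto_subseq'
      (x := fun n l => (p n).1 l / ∑ l, (p n).1 l) (Eventually.frequently <| by
        filter_upwards [hpos] with n hn
        exact ⟨fun l => div_nonneg ((hpW n).1 l) hn.le, by rw [← Finset.sum_div, div_self hn.ne']⟩)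
    have hTφ := hT.comp hφ.tendsto_atTop
    have hposφ := hφ.tendsto_atTop.eventually hpos
    have hliml : ∀ l, Tendsto (fun n => (p (φ n)).1 l / ∑ l, (p (φ n)).1 l) atTop (𝓝 (d l)) :=
      fun l => (tendsto_pi_nhds.1 hlim) l
    have hrec : ∀ ρ ∈ M.occupancySet, ∑ l, d l * (cumul (M.c l) ρ - C l) ≤ 0 := by
      intro ρ hρ
      refine le_of_tendsto_of_tendsto
        (tendsto_finsetSum _ fun l _ => (hliml l).mul_const (cumul (M.c l) ρ - C l))
        (hTφ.const_div_atTop (M.loss β C p₀ - M.primalObj β ρ)) ?_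
      filter_upwards [hposφ] with n hn
      simp only [div_mul_eq_mul_div, ← Finset.sum_div]
      refine div_le_div_of_nonneg_right ?_ hn.le
      have h1 := (M.saddle_le_loss hβ C _ hρ).trans (hle₀ (φ n))
      have h2 := M.primalObj_le_of_mem_stdSimplex β (hpW (φ n)).2 ρ
      rw [saddle] at h1
      linarith
    have hzero := hS.sum_mul_eq_zero hd.1 hrec
    have hge : ∀ᶠ n in atTop, ∀ l, d l ≤ (p (φ n)).1 l := by
      refine eventually_all.2 fun l => ?_
      rcases (hd.1 l).eq_or_lt with h0 | h0
      · exact Eventually.of_forall fun n => h0 ▸ (hpW (φ n)).1 l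
      · have h1 : Tendsto (fun n => (p (φ n)).1 l) atTop atTop := by
          refine ((hliml l).pos_mul_atTop h0 hTφ).congr' ?_
          filter_upwards [hposφ] with n hn
          exact div_mul_cancel₀ _ hn.ne'
        exact h1.eventually_ge_atTop (d l)
    obtain ⟨n, hn⟩ := hge.exists
    have h1 := hpmin (φ n) ((p (φ n)).1 - d, (p (φ n)).2)
      ⟨fun l => sub_nonneg.2 (hn l), (hpW (φ n)).2⟩
    have h2 := M.loss_sub_le hβ hzero (p (φ n)).1 (p (φ n)).2
    simp only [Pi.sub_apply, Finset.sum_sub_distrib, hd.2] at h1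
    have h3 := hε (φ n)
    simp only [Prod.mk.eta] at h2
    linarith
  · rw [tendsto_atTop] at hT
    obtain ⟨B, hB⟩ := not_forall.1 hT
    have hcpt : IsCompact (Set.Icc (0 : Fin L → ℝ) (fun _ => B) ×ˢ stdSimplex ℝ (Fin K)) :=
      isCompact_Icc.prod (isCompact_stdSimplex ℝ _)
    obtain ⟨x, hx, φ, hφ, hlim⟩ := hcpt.tendsto_subseq' (x := p)
      ((not_eventually.1 hB).mono fun n hn => ⟨⟨(hpW n).1, fun l =>
        (Finset.single_le_sum (fun l _ => (hpW n).1 l) (Finset.mem_univ l)).trans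
          (not_le.1 hn).le⟩, (hpW n).2⟩)
    refine ⟨x, ⟨hx.1.1, hx.2⟩, fun q hq => ?_⟩
    have h1 : Tendsto (fun n => M.loss β C q + ε (φ n) * ∑ l, q.1 l) atTop
        (𝓝 (M.loss β C q + 0 * ∑ l, q.1 l)) :=
      ((hε0.comp hφ.tendsto_atTop).mul_const _).const_add _
    rw [zero_mul, add_zero] at h1
    exact le_of_tendsto_of_tendsto' (((M.continuous_loss hβ C).tendsto x).comp hlim) h1
      fun n => hle (φ n) q hq

/-! ### Strong duality -/

theorem IsSoftOptimal.unique {M : MOMDP S A K L} [Nonempty A] {β : ℝ} (hβ : 0 < β)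
    {p : (Fin L → ℝ) × (Fin K → ℝ)} {ρ ρ' : S → A → ℝ} (hρ : ρ ∈ M.occupancySet)
    (h : M.IsSoftOptimal β p ρ) (hρ' : ρ' ∈ M.occupancySet) (h' : M.IsSoftOptimal β p ρ') :
    ρ = ρ' := by
  let π := fun s => softmax β (M.qValue p.1 p.2 (M.softValue β p.1 p.2) s)
  have hflow : ∀ ρ ∈ M.occupancySet, M.IsSoftOptimal β p ρ → ∀ s', ∑ a, ρ s' a
      = M.init s' + M.disc * ∑ s, (∑ a, ρ s a) * ∑ a, π s a * M.trans s a s' := by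
    intro ρ hρ h s'
    rw [hρ.2, inflow]
    congr 2
    refine Finset.sum_congr rfl fun s _ => ?_
    rw [Finset.mul_sum]
    refine Finset.sum_congr rfl fun a _ => ?_
    rw [h s a]
    ring
  have h1 := sum_abs_le_of_flow M.disc_nonneg
    (P := fun s s' => ∑ a, π s a * M.trans s a s') (b := fun _ => 0)
    (m := fun s => ∑ a, ρ s a - ∑ a, ρ' s a)
    (fun s s' => Finset.sum_nonneg fun a _ =>
      mul_nonneg (softmax_pos β _ a).le ((M.trans_mem s a).1 s'))
    (fun s => by
      rw [Finset.sum_comm]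
      simp_rw [← Finset.mul_sum, (M.trans_mem s _).2, mul_one]
      exact sum_softmax hβ _)
    (fun s' => by
      rw [hflow ρ hρ h s', hflow ρ' hρ' h' s']
      simp only [sub_mul, Finset.sum_sub_distrib]
      ring)
  simp only [abs_zero, Finset.sum_const_zero] at h1
  have h2 : ∑ s, |∑ a, ρ s a - ∑ a, ρ' s a| = 0 := le_antisymm
    (nonpos_of_mul_nonpos_right h1 (sub_pos.2 M.disc_lt_one))
    (Finset.sum_nonneg fun s _ => abs_nonneg _)
  ext s a
  have h3 := sub_eq_zero.1 (abs_eq_zero.1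
    ((Finset.sum_eq_zero_iff_of_nonneg fun s _ => abs_nonneg _).1 h2 s (Finset.mem_univ s)))
  rw [h s a, h' s a, h3]

theorem continuous_softmax_softValue [Nonempty A] (M : MOMDP S A K L) {β : ℝ} (hβ : 0 < β)
    (s : S) (a : A) : Continuous fun p : (Fin L → ℝ) × (Fin K → ℝ) =>
      softmax β (M.qValue p.1 p.2 (M.softValue β p.1 p.2) s) a := by
  have h := M.continuous_softValue hβ
  have hs : ∀ s, Continuous fun p : (Fin L → ℝ) × (Fin K → ℝ) => M.softValue β p.1 p.2 s :=
    continuous_pi_iff.1 h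
  have hs' := hs s
  simp only [softmax, M.logSumExp_qValue_softValue hβ, qValue]
  fun_prop

/-- Soft-optimal occupancy measures depend continuously on the weights, here in the form that a
subsequence converges: they lie in a compact set, and any limit point is again soft-optimal. -/
theorem exists_tendsto_softOptimal [Nonempty A] (M : MOMDP S A K L) {β : ℝ} (hβ : 0 < β)
    {p : (Fin L → ℝ) × (Fin K → ℝ)} {ρ : S → A → ℝ} (hρ : ρ ∈ M.occupancySet)
    (hopt : M.IsSoftOptimal β p ρ) {q : ℕ → (Fin L → ℝ) × (Fin K → ℝ)}
    (hq : Tendsto q atTop (𝓝 p)) {σ : ℕ → S → A → ℝ} (hσ : ∀ n, σ n ∈ M.occupancySet)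
    (hσopt : ∀ n, M.IsSoftOptimal β (q n) (σ n)) :
    ∃ φ : ℕ → ℕ, StrictMono φ ∧ Tendsto (σ ∘ φ) atTop (𝓝 ρ) := by
  obtain ⟨τ, hτ, φ, hφ, hlim⟩ := M.isCompact_occupancySet.tendsto_subseq hσ
  refine ⟨φ, hφ, ?_⟩
  have hτopt : M.IsSoftOptimal β p τ := by
    intro s a
    have hentry : ∀ a, Tendsto (fun n => σ (φ n) s a) atTop (𝓝 (τ s a)) := fun a =>
      tendsto_pi_nhds.1 (tendsto_pi_nhds.1 hlim s) a
    refine tendsto_nhds_unique (hentry a) ?_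
    simp_rw [(hσopt _) s a]
    exact (tendsto_finsetSum _ fun a _ => hentry a).mul
      (((M.continuous_softmax_softValue hβ s a).tendsto p).comp (hq.comp hφ.tendsto_atTop))
  rw [hopt.unique hβ hρ hτ hτopt]
  exact hlim

/-- First-order optimality: the soft-optimal occupancy measure at a minimizer `p` of the loss forms
a saddle point with `p`. Along the segment from `p` to `q`, the soft-optimal measure at the moving
point gives `q` at least the value of `p`; the inequality passes to the limit, because in the
difference of the two saddle functions the entropy cancels. -/
theorem loss_le_saddle_of_min [Nonempty A] (M : MOMDP S A K L) {β : ℝ} (hβ : 0 < β)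
    (C : Fin L → ℝ) {p : (Fin L → ℝ) × (Fin K → ℝ)} (hp : p ∈ weightSet K L)
    (hmin : ∀ q ∈ weightSet K L, M.loss β C p ≤ M.loss β C q) {ρ : S → A → ℝ}
    (hρ : ρ ∈ M.occupancySet) (hopt : M.IsSoftOptimal β p ρ)
    {q : (Fin L → ℝ) × (Fin K → ℝ)} (hq : q ∈ weightSet K L) :
    M.loss β C p ≤ M.saddle β C q ρ := by
  let t : ℕ → ℝ := fun n => 1 / ((n : ℝ) + 1)
  have ht : ∀ n, 0 < t n := fun n => Nat.one_div_pos_of_nat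
  have ht1 : ∀ n, t n ≤ 1 := fun n => by
    simp only [t]
    rw [div_le_one (by positivity)]
    linarith [(Nat.cast_nonneg n : (0 : ℝ) ≤ n)]
  have ht0 : Tendsto t atTop (𝓝 0) := tendsto_one_div_add_atTop_nhds_zero_nat
  have hx : Tendsto (fun n => (1 - t n) • p + t n • q) atTop (𝓝 p) := by
    have h := ((ht0.const_sub 1).smul_const p).add (ht0.smul_const q)
    simpa using h
  choose σ hσ hσopt using fun n => M.exists_isSoftOptimal hβ ((1 - t n) • p + t n • q)
  obtain ⟨φ, -, hφ⟩ := M.exists_tendsto_softOptimal hβ hρ hopt hx hσ hσopt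
  have hstep : ∀ n, M.saddle β C p (σ n) ≤ M.saddle β C q (σ n) := by
    intro n
    have h1 := hmin _ (convex_weightSet K L hp hq (sub_nonneg.2 (ht1 n)) (ht n).le (by ring))
    rw [← (hσopt n).saddle_eq_loss hβ C (hσ n), M.saddle_combo β C p q _ (by ring)] at h1
    have h2 := M.saddle_le_loss hβ C p (hσ n)
    have h3 : 0 ≤ t n * (M.saddle β C q (σ n) - M.saddle β C p (σ n)) := by linarith
    exact sub_nonneg.1 (nonneg_of_mul_nonneg_right h3 (ht n))
  let D : (S → A → ℝ) → ℝ := fun ρ => ∑ k, (q.2 k - p.2 k) * cumul (M.r k) ρ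
    + ∑ l, (q.1 l - p.1 l) * (cumul (M.c l) ρ - C l)
  have hD : ∀ ρ, D ρ = M.saddle β C q ρ - M.saddle β C p ρ := fun ρ => by
    simp only [D, saddle, sub_mul, Finset.sum_sub_distrib]
    ring
  have hDcont : Continuous D := by
    have h1 := fun k => continuous_cumul (M.r k)
    have h2 := fun l => continuous_cumul (M.c l)
    simp only [D]
    fun_prop
  have h0 : 0 ≤ D ρ := ge_of_tendsto' ((hDcont.tendsto ρ).comp hφ) fun n => by
    simp only [Function.comp_apply, hD]
    exact sub_nonneg.2 (hstep (φ n))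
  rw [← hopt.saddle_eq_loss hβ C hρ]
  exact sub_nonneg.1 (hD ρ ▸ h0)

theorem exists_feasible_of_min [Nonempty A] (hK : 1 ≤ K) (M : MOMDP S A K L) {β : ℝ} (hβ : 0 < β)
    (C : Fin L → ℝ) {p : (Fin L → ℝ) × (Fin K → ℝ)} (hp : p ∈ weightSet K L)
    (hmin : ∀ q ∈ weightSet K L, M.loss β C p ≤ M.loss β C q) :
    ∃ ρ ∈ M.feasibleSet C, M.primalObj β ρ = M.loss β C p := by
  obtain ⟨ρ, hρ, hopt⟩ := M.exists_isSoftOptimal hβ p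
  have hsad := fun q hq => M.loss_le_saddle_of_min hβ C hp hmin hρ hopt (q := q) hq
  have hfeas : ρ ∈ M.feasibleSet C := by
    refine ⟨hρ, fun l => ?_⟩
    -- raising the multiplier of one constraint must not lower the saddle function
    have h := hsad (p.1 + Pi.single l 1, p.2)
      ⟨Set.mem_Ici.2 (add_nonneg hp.1 (Pi.single_nonneg.2 zero_le_one)), hp.2⟩
    rw [← hopt.saddle_eq_loss hβ C hρ] at h
    simp only [saddle, Pi.add_apply, add_mul, Finset.sum_add_distrib, Pi.single_apply, ite_mul,
      one_mul, zero_mul, Finset.sum_ite_eq', Finset.mem_univ, if_true] at h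
    linarith
  refine ⟨ρ, hfeas, le_antisymm (M.primalObj_le_loss hβ C hfeas hp) ?_⟩
  have : Nonempty (Fin K) := ⟨⟨0, hK⟩⟩
  obtain ⟨k, hk⟩ := exists_eq_ciInf_of_finite (f := fun k : Fin K => cumul (M.r k) ρ)
  have h := hsad (0, Pi.single k 1) ⟨Set.mem_Ici.2 le_rfl, single_mem_stdSimplex ℝ k⟩
  simp only [saddle, Pi.single_apply, ite_mul, one_mul, zero_mul, Finset.sum_ite_eq',
    Finset.mem_univ, if_true, Pi.zero_apply, Finset.sum_const_zero, add_zero] at h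
  rwa [primalObj, ← hk]

end MOMDP

theorem proposition3p2 {S A : Type*} [Fintype S] [Fintype A] [Nonempty A] {K L : ℕ} (hK : 1 ≤ K)
    (M : MOMDP S A K L) (β : ℝ) (hβ : 0 < β) (C : Fin L → ℝ) :
    -- `T_{u,w}` has exactly one fixed point, `v*_{u,w}`, for all real vectors `u`, `w`
    (∀ (u : Fin L → ℝ) (w : Fin K → ℝ) (v : S → ℝ),
      Function.IsFixedPt (M.softBellman β u w) v ↔ v = M.softValue β u w) ∧
    -- convexity of `v*_{u,w}(s)` in `(u, w)` and of the reduced program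
    (∀ s : S, ConvexOn ℝ Set.univ
      fun p : (Fin L → ℝ) × (Fin K → ℝ) => M.softValue β p.1 p.2 s) ∧
    ConvexOn ℝ (MOMDP.weightSet K L) (M.loss β C) ∧
    -- the dual problem reduces to the minimization of `ℒ` over `ℝ₊^L × Δ^K`
    (∀ (u : Fin L → ℝ) (w : Fin K → ℝ), 0 ≤ u → 0 ≤ w → w ∉ stdSimplex ℝ (Fin K) →
      ∀ (v : S → ℝ) (ξ : S → A → ℝ), 0 ≤ ξ → M.dualFun β C u w v ξ = ⊤) ∧
    (∀ (u : Fin L → ℝ) (w : Fin K → ℝ), (u, w) ∈ MOMDP.weightSet K L →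
      M.dualFun β C u w (M.softValue β u w) 0 = ((M.loss β C (u, w) : ℝ) : EReal) ∧
      ∀ (v : S → ℝ) (ξ : S → A → ℝ), 0 ≤ ξ →
        ((M.loss β C (u, w) : ℝ) : EReal) ≤ M.dualFun β C u w v ξ) ∧
    M.dualValue β C = ⨅ p ∈ MOMDP.weightSet K L, ((M.loss β C p : ℝ) : EReal) ∧
    -- under Slater's condition primal, dual and reduced program have the same optimal value,
    -- a maximum in the primal and a minimum in the reduced program
    (M.Slater C → ∃ val : ℝ,
      IsGreatest (M.primalObj β '' M.feasibleSet C) val ∧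
      M.dualValue β C = (val : EReal) ∧
      IsLeast (M.loss β C '' MOMDP.weightSet K L) val) := by
  refine ⟨fun u w v => M.isFixedPt_softBellman_iff hβ u w v, M.convexOn_softValue hβ,
    (M.convexOn_loss_univ hβ C).subset (Set.subset_univ _) (MOMDP.convex_weightSet K L),
    fun u w _ hw hw1 v ξ _ => M.dualFun_eq_top β C u hw hw1 v ξ,
    fun u w hp => ⟨M.dualFun_softValue hβ C u hp.2, fun v ξ hξ => M.loss_le_dualFun hβ C u w v hξ⟩,
    M.dualValue_eq hβ C, fun hS => ?_⟩
  obtain ⟨p, hp, hmin⟩ := M.exists_min_loss hK hβ hS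
  obtain ⟨ρ, hρ, hval⟩ := M.exists_feasible_of_min hK hβ C hp hmin
  refine ⟨M.loss β C p, ⟨⟨ρ, hρ, hval⟩, ?_⟩, ?_, ⟨p, hp, rfl⟩, ?_⟩
  · rintro _ ⟨ρ', hρ', rfl⟩
    exact M.primalObj_le_loss hβ C hρ' hp
  · rw [M.dualValue_eq hβ C]
    exact le_antisymm (iInf₂_le p hp) (le_iInf₂ fun q hq => EReal.coe_le_coe_iff.2 (hmin q hq))
  · rintro _ ⟨q, hq, rfl⟩
    exact hmin q hq
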